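/- For a finite simple graph $G$ let $\mathscr{E}(G)$, the energy of $G$, be the sum of the absolute values of the eigenvalues (with multiplicity) of its adjacency matrix, and let $e(G)=\sum_{v\in V(G)}\bigl(\mathscr{E}(G)-\mathscr{E}(G-v)\bigr)$ be its local energy, where $G-v$ is obtained from $G$ by deleting the vertex $v$. Two graphs of the same order are called locally equienergetic if they have the same local energy. By a class of locally equienergetic graphs of order $n$ we mean the set of all graphs of order $n$, up to isomorphism, that have a given local energy, provided that it contains at least two non-isomorphic graphs. Proposition. There are exactly two classes of locally equienergetic graphs of order $5$, namely $\{K_5,\ K_3\cup K_2,\ C_5\}$ and $\{K_4\cup K_1,\ K_2\cup K_2\cup K_1\}$, where $\cup$ denotes disjoint union and the listed graphs are pairwise non-isomorphic. -/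

import Mathlib

namespace SimpleGraph

open Classical in
/-- The energy of a finite simple graph: the sum of the absolute values of the eigenvalues
(counted with multiplicity) of its adjacency matrix. -/
noncomputable def energy {V : Type*} [Fintype V] (G : SimpleGraph V) : ℝ :=
  ∑ i, |(G.isHermitian_adjMatrix ℝ).eigenvalues i|

/-- The local energy of `G` at the vertex `v`: the energy of `G` minus the energy of the graph
obtained from `G` by deleting `v`. -/
noncomputable def localEnergyAt {V : Type*} [Fintype V] [DecidableEq V] (G : SimpleGraph V)
    (v : V) : ℝ :=
  G.energy - (G.induce {w : V | w ≠ v}).energy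

open Classical in
/-- The local energy of `G`: the sum of its local energies at all vertices. -/
noncomputable def localEnergy {V : Type*} [Fintype V] (G : SimpleGraph V) : ℝ :=
  ∑ v, G.localEnergyAt v

/-- Two finite graphs are locally equienergetic if they have the same order and the same
local energy. -/
def LocallyEquienergetic {V W : Type*} [Fintype V] [Fintype W]
    (G : SimpleGraph V) (H : SimpleGraph W) : Prop :=
  Fintype.card V = Fintype.card W ∧ G.localEnergy = H.localEnergy

open Classical in
theorem energy_eq_roots {V : Type*} [Fintype V] (G : SimpleGraph V) :
    G.energy = ((G.adjMatrix ℝ).charpoly.roots.map (fun x => |x|)).sum := by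
  rw [(G.isHermitian_adjMatrix ℝ).roots_charpoly_eq_eigenvalues]
  simp [energy]

theorem energy_congr {V W : Type*} [Fintype V] [Fintype W] {G : SimpleGraph V}
    {H : SimpleGraph W} (f : G ≃g H) : G.energy = H.energy := by
  classical
  rw [energy_eq_roots, energy_eq_roots]
  have h : H.adjMatrix ℝ = Matrix.reindex f.toEquiv f.toEquiv (G.adjMatrix ℝ) := by
    ext i j
    have hf : G.Adj (f.symm i) (f.symm j) ↔ H.Adj i j := f.symm.map_adj_iff
    simp only [Matrix.reindex_apply, Matrix.submatrix_apply, SimpleGraph.adjMatrix_apply]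
    exact if_congr hf.symm rfl rfl
  rw [h, Matrix.charpoly_reindex]

theorem localEnergy_congr {V W : Type*} [Fintype V] [Fintype W] {G : SimpleGraph V}
    {H : SimpleGraph W} (f : G ≃g H) : G.localEnergy = H.localEnergy := by
  classical
  unfold localEnergy
  refine Fintype.sum_equiv f.toEquiv _ _ fun v => ?_
  unfold localEnergyAt
  rw [energy_congr f]
  congr 1
  refine energy_congr ⟨f.toEquiv.subtypeEquiv fun w => ?_, ?_⟩
  · simp
  · intro a b
    exact f.map_adj_iff

/-- Isomorphism of graphs on the vertex set `Fin n`. -/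
def isoSetoid (n : ℕ) : Setoid (SimpleGraph (Fin n)) where
  r G H := Nonempty (G ≃g H)
  iseqv := ⟨fun _ => ⟨Iso.refl⟩, fun ⟨f⟩ => ⟨f.symm⟩, fun ⟨f⟩ ⟨g⟩ => ⟨f.trans g⟩⟩

/-- The graphs of order `n`, considered up to isomorphism. -/
def GraphOfOrder (n : ℕ) : Type := Quotient (isoSetoid n)

/-- The isomorphism type of a graph `G` with `n` vertices. -/
noncomputable def isoType {V : Type*} [Fintype V] (G : SimpleGraph V) {n : ℕ}
    (h : Fintype.card V = n) : GraphOfOrder n :=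
  Quotient.mk (isoSetoid n) (G.overFin h)

/-- Local equienergeticity as an equivalence relation on the graphs of order `n` up to
isomorphism. -/
def locallyEquienergeticSetoid (n : ℕ) : Setoid (GraphOfOrder n) where
  r x y := Quotient.liftOn₂ x y (fun G H => G.LocallyEquienergetic H) (by
    rintro G H G' H' ⟨f⟩ ⟨g⟩
    simp only [LocallyEquienergetic, localEnergy_congr f, localEnergy_congr g])
  iseqv := by
    refine ⟨?_, ?_, ?_⟩
    · rintro ⟨G⟩
      exact ⟨rfl, rfl⟩
    · rintro ⟨G⟩ ⟨H⟩ h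
      exact ⟨h.1.symm, h.2.symm⟩
    · rintro ⟨G⟩ ⟨H⟩ ⟨K⟩ h h'
      exact ⟨h.1.trans h'.1, h.2.trans h'.2⟩

/-- The classes of locally equienergetic graphs of order `n`: the equivalence classes of the
relation "locally equienergetic" on the graphs of order `n` up to isomorphism which contain at
least two non-isomorphic graphs. -/
def locallyEquienergeticClasses (n : ℕ) : Set (Set (GraphOfOrder n)) :=
  {C | C ∈ (locallyEquienergeticSetoid n).classes ∧ C.Nontrivial}

end SimpleGraph

/-!
The local energy of a graph of order 5 is five times its energy minus the energies of its five
vertex-deleted subgraphs. Completing each subgraph by an isolated vertex, which adds an eigenvalue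
`0` (`energy_eq_energy_induce_of_isolated`), leaves only energies of graphs on `Fin 5`.

Up to isomorphism there are 34 such graphs, listed in `edgeLists`: the empty graph is in the list,
and the list is closed, up to isomorphism, under adding an edge (`exists_iso_ofEdges`). Their
characteristic polynomials have explicit integer coefficients (`charpoly_eq_toPoly`), and
`charpolyTable` factors each of them into linear factors `X - a` with `a` an integer and factors
whose roots are simple and lie in disjoint intervals of length `10⁻⁵` found by sign changes. As a
polynomial has no more roots than its degree, these are all the roots, so that every energy, and
hence every local energy, lies between computable rational bounds (`energy_ofEdges_mem`,
`localEnergy_ofEdges_mem`). The intervals are short enough for the bounds to separate any two of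
the 34 local energies, apart from those of `K₅`, `K₃ ∪ K₂`, `C₅` and those of `K₄ ∪ K₁`,
`K₂ ∪ K₂ ∪ K₁` (`localEnergy_bounds_separate`).

It remains to see that these are equal. All graphs involved have integral spectrum, so that the
bounds are exact and give 10, 10 and 8, 8, except `C₅` and its subgraph `P₄`. For them the
irrational parts cancel, and the local energy is 10 as well (`localEnergy_edgesC5`). Within a class
the graphs are told apart by their energies.
-/

open Polynomial

namespace SimpleGraph

/-! ### Graphs given by edge lists, and their characteristic polynomials -/

/-- The graph on `Fin 5` with the listed edges; the order of the two ends of a pair is irrelevant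
and loops are ignored. -/
def ofEdges (l : List (Fin 5 × Fin 5)) : SimpleGraph (Fin 5) :=
  fromRel fun i j => (i, j) ∈ l

instance (l : List (Fin 5 × Fin 5)) : DecidableRel (ofEdges l).Adj :=
  fun i j => inferInstanceAs (Decidable (i ≠ j ∧ ((i, j) ∈ l ∨ (j, i) ∈ l)))

/-- The coefficients, constant term first, of the characteristic polynomial of a symmetric `5 × 5`
matrix with zero diagonal. Each is a signed sum over the ways to place disjoint edges and cycles on
the vertices. Only the entries above the diagonal are used. -/
def symmCharCoeffs (a : Fin 5 → Fin 5 → ℤ) : List ℤ :=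
  [2 * (a 0 1 * a 0 2 * a 1 2 * a 3 4 ^ 2 + a 0 1 * a 0 3 * a 1 3 * a 2 4 ^ 2 +
      a 0 1 * a 0 4 * a 1 4 * a 2 3 ^ 2 + a 0 2 * a 0 3 * a 2 3 * a 1 4 ^ 2 +
      a 0 2 * a 0 4 * a 2 4 * a 1 3 ^ 2 + a 0 3 * a 0 4 * a 3 4 * a 1 2 ^ 2 +
      a 1 2 * a 1 3 * a 2 3 * a 0 4 ^ 2 + a 1 2 * a 1 4 * a 2 4 * a 0 3 ^ 2 +
      a 1 3 * a 1 4 * a 3 4 * a 0 2 ^ 2 + a 2 3 * a 2 4 * a 3 4 * a 0 1 ^ 2) -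
    2 * (a 0 1 * a 1 2 * a 2 3 * a 3 4 * a 0 4 + a 0 1 * a 1 2 * a 2 4 * a 3 4 * a 0 3 +
      a 0 1 * a 1 3 * a 2 3 * a 2 4 * a 0 4 + a 0 1 * a 1 3 * a 3 4 * a 2 4 * a 0 2 +
      a 0 1 * a 1 4 * a 2 4 * a 2 3 * a 0 3 + a 0 1 * a 1 4 * a 3 4 * a 2 3 * a 0 2 +
      a 0 2 * a 1 2 * a 1 3 * a 3 4 * a 0 4 + a 0 2 * a 1 2 * a 1 4 * a 3 4 * a 0 3 +
      a 0 2 * a 2 3 * a 1 3 * a 1 4 * a 0 4 + a 0 2 * a 2 4 * a 1 4 * a 1 3 * a 0 3 +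
      a 0 3 * a 1 3 * a 1 2 * a 2 4 * a 0 4 + a 0 3 * a 2 3 * a 1 2 * a 1 4 * a 0 4),
    a 0 1 ^ 2 * a 2 3 ^ 2 + a 0 2 ^ 2 * a 1 3 ^ 2 + a 0 3 ^ 2 * a 1 2 ^ 2 +
      a 0 1 ^ 2 * a 2 4 ^ 2 + a 0 2 ^ 2 * a 1 4 ^ 2 + a 0 4 ^ 2 * a 1 2 ^ 2 +
      a 0 1 ^ 2 * a 3 4 ^ 2 + a 0 3 ^ 2 * a 1 4 ^ 2 + a 0 4 ^ 2 * a 1 3 ^ 2 +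
      a 0 2 ^ 2 * a 3 4 ^ 2 + a 0 3 ^ 2 * a 2 4 ^ 2 + a 0 4 ^ 2 * a 2 3 ^ 2 +
      a 1 2 ^ 2 * a 3 4 ^ 2 + a 1 3 ^ 2 * a 2 4 ^ 2 + a 1 4 ^ 2 * a 2 3 ^ 2 -
    2 * (a 0 1 * a 1 2 * a 2 3 * a 0 3 + a 0 2 * a 1 2 * a 1 3 * a 0 3 +
      a 0 1 * a 1 3 * a 2 3 * a 0 2 + a 0 1 * a 1 2 * a 2 4 * a 0 4 +
      a 0 2 * a 1 2 * a 1 4 * a 0 4 + a 0 1 * a 1 4 * a 2 4 * a 0 2 +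
      a 0 1 * a 1 3 * a 3 4 * a 0 4 + a 0 3 * a 1 3 * a 1 4 * a 0 4 +
      a 0 1 * a 1 4 * a 3 4 * a 0 3 + a 0 2 * a 2 3 * a 3 4 * a 0 4 +
      a 0 3 * a 2 3 * a 2 4 * a 0 4 + a 0 2 * a 2 4 * a 3 4 * a 0 3 +
      a 1 2 * a 2 3 * a 3 4 * a 1 4 + a 1 3 * a 2 3 * a 2 4 * a 1 4 +
      a 1 2 * a 2 4 * a 3 4 * a 1 3),
    -2 * (a 0 1 * a 0 2 * a 1 2 + a 0 1 * a 0 3 * a 1 3 + a 0 1 * a 0 4 * a 1 4 +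
      a 0 2 * a 0 3 * a 2 3 + a 0 2 * a 0 4 * a 2 4 + a 0 3 * a 0 4 * a 3 4 +
      a 1 2 * a 1 3 * a 2 3 + a 1 2 * a 1 4 * a 2 4 + a 1 3 * a 1 4 * a 3 4 +
      a 2 3 * a 2 4 * a 3 4),
    -(a 0 1 ^ 2 + a 0 2 ^ 2 + a 0 3 ^ 2 + a 0 4 ^ 2 + a 1 2 ^ 2 + a 1 3 ^ 2 + a 1 4 ^ 2 +
      a 2 3 ^ 2 + a 2 4 ^ 2 + a 3 4 ^ 2),
    0, 1]

/-- The coefficients, constant term first, of the characteristic polynomial of `ofEdges l`. -/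
def charCoeffs (l : List (Fin 5 × Fin 5)) : List ℤ :=
  symmCharCoeffs fun i j => if (ofEdges l).Adj i j then 1 else 0

/-- Addition of polynomials given by coefficient lists, constant term first. -/
def addCoeffs : List ℤ → List ℤ → List ℤ
  | [], q => q
  | p, [] => p
  | a :: p, b :: q => (a + b) :: addCoeffs p q

/-- Multiplication of polynomials given by coefficient lists, constant term first. -/
def mulCoeffs : List ℤ → List ℤ → List ℤ
  | [], _ => []
  | a :: p, q => addCoeffs (q.map (a * ·)) (0 :: mulCoeffs p q)

/-- The homogenization at `(m, N)` of the polynomial with the given coefficients, that is,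
`N` to the number of coefficients minus one, times the value at `m / N`. For `N > 0` it has the sign
of that value. -/
def homEval (m N : ℤ) : List ℤ → ℤ
  | [] => 0
  | a :: p => a * N ^ p.length + m * homEval m N p

/-! ### Factors with isolated roots -/

/-- A polynomial, given by its coefficients with the constant term first, together with brackets
for its real roots: `(m, k)` stands for the closed interval `[m / scale, k / scale]`. -/
structure IsolatedFactor where
  coeffs : List ℤ
  brackets : List (ℤ × ℤ)

namespace IsolatedFactor

/-- The common denominator of the ends of all brackets. -/
abbrev scale : ℤ := 100000

/-- The brackets are increasing and disjoint, there are as many as the degree, and the polynomial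
does not have the same strict sign at both ends of any of them. Hence each contains exactly one
root. -/
def Valid (f : IsolatedFactor) : Prop :=
  f.coeffs.length = f.brackets.length + 1 ∧ f.coeffs.getD f.brackets.length 0 ≠ 0 ∧
    f.brackets.Pairwise (fun b c => b.2 < c.1) ∧
    ∀ b ∈ f.brackets, b.1 ≤ b.2 ∧ homEval b.1 scale f.coeffs * homEval b.2 scale f.coeffs ≤ 0

instance : DecidablePred Valid := fun f => by unfold Valid; infer_instance

/-- A lower bound for `scale` times the sum of the absolute values of the roots: whatever the signs
of `m` and `k`, every `x` in `[m, k]` has `max m (-k) ≤ |x|`. -/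
def lower (f : IsolatedFactor) : ℤ := (f.brackets.map fun b => max b.1 (-b.2)).sum

/-- An upper bound for `scale` times the sum of the absolute values of the roots: every `x` in
`[m, k]` has `|x| ≤ max (-m) k`. -/
def upper (f : IsolatedFactor) : ℤ := (f.brackets.map fun b => max (-b.1) b.2).sum

/-- The factor `X - a`, whose bracket is the single point `a`, so that its bounds are exact. -/
def lin (a : ℤ) : IsolatedFactor := ⟨[-a, 1], [(a * scale, a * scale)]⟩

/-- The factor with coefficient list `p` and a root in `[k / scale, (k + 1) / scale]` for each `k`
in `m`. -/
def isolated (p m : List ℤ) : IsolatedFactor := ⟨p, m.map fun k => (k, k + 1)⟩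

end IsolatedFactor

open IsolatedFactor in
/-- The characteristic polynomials of the graphs of order 5 (33 of them, as `K₁,₄` and `C₄ ∪ K₁` are
cospectral), each with a factorization into factors with simple, isolated roots. -/
def charpolyTable : List (List ℤ × List IsolatedFactor) :=
  [([0, 0, 0, 0, 0, 1], [lin 0, lin 0, lin 0, lin 0, lin 0]),
   ([0, 0, 0, -1, 0, 1], [lin (-1), lin 0, lin 0, lin 0, lin 1]),
   ([0, 0, 0, -2, 0, 1], [lin 0, lin 0, lin 0, isolated [-2, 0, 1] [-141422, 141421]]),
   ([0, 1, 0, -2, 0, 1], [lin (-1), lin (-1), lin 0, lin 1, lin 1]),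
   ([0, 0, 0, -3, 0, 1], [lin 0, lin 0, lin 0, isolated [-3, 0, 1] [-173206, 173205]]),
   ([0, 0, -2, -3, 0, 1], [lin (-1), lin (-1), lin 0, lin 0, lin 2]),
   ([0, 1, 0, -3, 0, 1], [lin 0, isolated [-1, 1, 1] [-161804, 61803],
      isolated [-1, -1, 1] [-61804, 161803]]),
   ([0, 2, 0, -3, 0, 1], [lin (-1), lin 0, lin 1, isolated [-2, 0, 1] [-141422, 141421]]),
   ([0, 0, 0, -4, 0, 1], [lin (-2), lin 0, lin 0, lin 0, lin 2]),
   ([0, 1, -2, -4, 0, 1], [lin (-1), lin 0, isolated [1, -3, -1, 1] [-148120, 31110, 217008]]),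
   ([0, 3, 0, -4, 0, 1], [lin (-1), lin 0, lin 1, isolated [-3, 0, 1] [-173206, 173205]]),
   ([0, 2, 0, -4, 0, 1], [lin 0, isolated [2, 0, -4, 0, 1] [-184776, -76537, 76536, 184775]]),
   ([2, 3, -2, -4, 0, 1], [lin (-1), lin (-1), lin (-1), lin 1, lin 2]),
   ([0, 0, -4, -5, 0, 1], [lin (-1), lin 0, lin 0, isolated [-4, -1, 1] [-156156, 256155]]),
   ([0, 2, 0, -5, 0, 1], [lin 0, isolated [2, 0, -5, 0, 1] [-213578, -66216, 66215, 213577]]),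
   ([0, 3, -2, -5, 0, 1], [lin 0, isolated [3, -2, -5, 0, 1] [-161804, -130278, 61803, 230277]]),
   ([0, 2, -2, -5, 0, 1], [lin (-1), lin 0, isolated [2, -4, -1, 1] [-181361, 47068, 234292]]),
   ([-2, 5, 0, -5, 0, 1], [lin 2, isolated [-1, 1, 1] [-161804, 61803],
      isolated [-1, 1, 1] [-161804, 61803]]),
   ([2, 4, -2, -5, 0, 1], [lin (-1), lin 1, isolated [-2, -4, 0, 1] [-167514, -53919, 221431]]),
   ([0, 0, 0, -6, 0, 1], [lin 0, lin 0, lin 0, isolated [-6, 0, 1] [-244949, 244948]]),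
   ([0, -3, -8, -6, 0, 1], [lin (-1), lin (-1), lin (-1), lin 0, lin 3]),
   ([0, 4, -2, -6, 0, 1], [lin (-2), lin 0, isolated [2, -2, -2, 1] [-117009, 68889, 248119]]),
   ([0, 2, -4, -6, 0, 1], [lin 0, isolated [2, -4, -6, 0, 1] [-174912, -127134, 33490, 268554]]),
   ([2, 3, -4, -6, 0, 1], [lin (-1), isolated [2, 1, -5, -1, 1] [-177572, -58922, 72374, 264118]]),
   ([4, 5, -4, -6, 0, 1], [lin (-1), lin (-1), lin 1, isolated [-4, -1, 1] [-156156, 256155]]),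
   ([0, 0, -6, -7, 0, 1], [lin (-2), lin (-1), lin 0, lin 0, lin 3]),
   ([0, 2, -4, -7, 0, 1], [lin (-1), lin 0, isolated [2, -6, -1, 1] [-217741, 32163, 285577]]),
   ([2, 0, -8, -7, 0, 1], [lin (-1), lin (-1), isolated [2, -4, -2, 1] [-151414, 42800, 308613]]),
   ([2, 3, -6, -7, 0, 1],
      [isolated [2, 3, -6, -7, 0, 1] [-161804, -147284, -46260, 61803, 293543]]),
   ([0, 0, -8, -8, 0, 1], [lin (-2), lin 0, lin 0, isolated [-4, -2, 1] [-123607, 323606]]),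
   ([2, -1, -10, -8, 0, 1], [lin (-1), lin (-1), isolated [2, -5, -2, 1] [-168134, 35792, 332340]]),
   ([0, -6, -14, -9, 0, 1], [lin (-1), lin (-1), lin 0, isolated [-6, -2, 1] [-164576, 364575]]),
   ([-4, -15, -20, -10, 0, 1], [lin (-1), lin (-1), lin (-1), lin (-1), lin 4])]

/-- The tabulated factors of the characteristic polynomial of `ofEdges l`; empty if it is not in the
table. -/
def charFactors (l : List (Fin 5 × Fin 5)) : List IsolatedFactor :=
  (charpolyTable.lookup (charCoeffs l)).getD []

/-- The edges that avoid `v`. The vertex `v` stays in `ofEdges (deleteVertex l v)`, isolated, which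
keeps all graphs on `Fin 5` and does not change the energy. -/
def deleteVertex (l : List (Fin 5 × Fin 5)) (v : Fin 5) : List (Fin 5 × Fin 5) :=
  l.filter fun e => e.1 ≠ v ∧ e.2 ≠ v

/-- A lower bound for `scale` times the energy of `ofEdges l`, if `charpolyTable` covers it. -/
def energyLower (l : List (Fin 5 × Fin 5)) : ℤ := ((charFactors l).map IsolatedFactor.lower).sum

/-- An upper bound for `scale` times the energy of `ofEdges l`, if `charpolyTable` covers it. -/
def energyUpper (l : List (Fin 5 × Fin 5)) : ℤ := ((charFactors l).map IsolatedFactor.upper).sum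

/-- A lower bound for `scale` times the local energy of `ofEdges l`, if `charpolyTable` covers this
graph and its vertex-deleted subgraphs. -/
def localEnergyLower (l : List (Fin 5 × Fin 5)) : ℤ :=
  ((List.finRange 5).map fun v => energyLower l - energyUpper (deleteVertex l v)).sum

/-- An upper bound for `scale` times the local energy of `ofEdges l`, if `charpolyTable` covers this
graph and its vertex-deleted subgraphs. -/
def localEnergyUpper (l : List (Fin 5 × Fin 5)) : ℤ :=
  ((List.finRange 5).map fun v => energyUpper l - energyLower (deleteVertex l v)).sum

/-- Edge lists of the 34 graphs of order 5, one for each isomorphism type, by increasing size. -/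
def edgeLists : List (List (Fin 5 × Fin 5)) :=
  [[], [(0, 1)], [(0, 1), (0, 2)], [(0, 1), (2, 3)], [(0, 1), (0, 2), (0, 3)],
   [(0, 1), (0, 2), (1, 2)], [(0, 1), (0, 2), (1, 3)], [(0, 1), (0, 2), (3, 4)],
   [(0, 1), (0, 2), (1, 3), (2, 3)], [(0, 1), (0, 2), (0, 3), (0, 4)],
   [(0, 1), (0, 2), (0, 3), (1, 2)], [(0, 1), (0, 2), (1, 3), (2, 4)],
   [(0, 1), (0, 2), (0, 3), (1, 4)], [(0, 1), (0, 2), (1, 2), (3, 4)],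
   [(0, 1), (0, 2), (0, 3), (1, 2), (1, 3)], [(0, 1), (0, 2), (0, 3), (1, 4), (2, 4)],
   [(0, 1), (0, 2), (0, 3), (1, 2), (1, 4)], [(0, 1), (0, 2), (0, 3), (0, 4), (1, 2)],
   [(0, 1), (0, 2), (1, 3), (2, 4), (3, 4)], [(0, 1), (0, 2), (0, 3), (1, 2), (3, 4)],
   [(0, 1), (0, 2), (0, 3), (1, 4), (2, 4), (3, 4)],
   [(0, 1), (0, 2), (0, 3), (1, 2), (1, 3), (2, 3)],
   [(0, 1), (0, 2), (0, 3), (1, 2), (1, 4), (3, 4)],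
   [(0, 1), (0, 2), (0, 3), (0, 4), (1, 2), (1, 3)],
   [(0, 1), (0, 2), (0, 3), (1, 2), (1, 3), (2, 4)],
   [(0, 1), (0, 2), (0, 3), (0, 4), (1, 2), (3, 4)],
   [(0, 1), (0, 2), (0, 3), (0, 4), (1, 2), (1, 3), (1, 4)],
   [(0, 1), (0, 2), (0, 3), (1, 2), (1, 3), (2, 4), (3, 4)],
   [(0, 1), (0, 2), (0, 3), (0, 4), (1, 2), (1, 3), (2, 3)],
   [(0, 1), (0, 2), (0, 3), (0, 4), (1, 2), (1, 3), (2, 4)],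
   [(0, 1), (0, 2), (0, 3), (0, 4), (1, 2), (1, 3), (2, 4), (3, 4)],
   [(0, 1), (0, 2), (0, 3), (0, 4), (1, 2), (1, 3), (1, 4), (2, 3)],
   [(0, 1), (0, 2), (0, 3), (0, 4), (1, 2), (1, 3), (1, 4), (2, 3), (2, 4)],
   [(0, 1), (0, 2), (0, 3), (0, 4), (1, 2), (1, 3), (1, 4), (2, 3), (2, 4), (3, 4)]]

/-! ### Finite checks -/

/-- The tabulated factors multiply to the tabulated polynomials, and their brackets isolate their
roots. -/
theorem charpolyTable_valid : ∀ r ∈ charpolyTable,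
    (r.2.map IsolatedFactor.coeffs).foldr mulCoeffs [1] = r.1 ∧ ∀ f ∈ r.2, f.Valid := by
  decide +kernel

/-- The table covers the listed graphs and their vertex-deleted subgraphs. -/
theorem lookup_charCoeffs_ne_none : ∀ l ∈ edgeLists, charpolyTable.lookup (charCoeffs l) ≠ none ∧
    ∀ v, charpolyTable.lookup (charCoeffs (deleteVertex l v)) ≠ none := by
  decide +kernel

/-- An isomorphism `G ≃g H` spelled out as a choice of the images of `0, 1, 2, 3, 4` in turn. Each
image is tested against the preceding ones before the next is chosen, so that deciding the
proposition is a backtracking search. -/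
def IsoSearch (G H : SimpleGraph (Fin 5)) : Prop :=
  ∃ a, ∃ b, (b ≠ a ∧ (H.Adj a b ↔ G.Adj 0 1)) ∧
  ∃ c, (c ≠ a ∧ c ≠ b ∧ (H.Adj a c ↔ G.Adj 0 2) ∧ (H.Adj b c ↔ G.Adj 1 2)) ∧
  ∃ d, (d ≠ a ∧ d ≠ b ∧ d ≠ c ∧ (H.Adj a d ↔ G.Adj 0 3) ∧ (H.Adj b d ↔ G.Adj 1 3) ∧
    (H.Adj c d ↔ G.Adj 2 3)) ∧
  ∃ e, e ≠ a ∧ e ≠ b ∧ e ≠ c ∧ e ≠ d ∧ (H.Adj a e ↔ G.Adj 0 4) ∧ (H.Adj b e ↔ G.Adj 1 4) ∧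
    (H.Adj c e ↔ G.Adj 2 4) ∧ (H.Adj d e ↔ G.Adj 3 4)

set_option synthInstance.maxSize 4000 in
set_option synthInstance.maxHeartbeats 400000 in
instance (G H : SimpleGraph (Fin 5)) [DecidableRel G.Adj] [DecidableRel H.Adj] :
    Decidable (IsoSearch G H) := by unfold IsoSearch; infer_instance

/-- Up to isomorphism, the graphs of `edgeLists` are closed under adding an edge. The size and the
characteristic polynomial of the new graph are compared first, which leaves hardly any failing
searches. -/
theorem exists_isoSearch_cons : ∀ l ∈ edgeLists, ∀ j, ∀ i < j, (i, j) ∉ l → ∃ l' ∈ edgeLists,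
    l'.length = l.length + 1 ∧ charCoeffs l' = charCoeffs ((i, j) :: l) ∧
      IsoSearch (ofEdges ((i, j) :: l)) (ofEdges l') := by
  decide +kernel

/-- The edge list of `K₅` that occurs in `edgeLists`. -/
abbrev edgesK5 : List (Fin 5 × Fin 5) :=
  [(0, 1), (0, 2), (0, 3), (0, 4), (1, 2), (1, 3), (1, 4), (2, 3), (2, 4), (3, 4)]

/-- The edge list of `K₃ ∪ K₂` that occurs in `edgeLists`. -/
abbrev edgesK3K2 : List (Fin 5 × Fin 5) := [(0, 1), (0, 2), (1, 2), (3, 4)]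

/-- The edge list of `C₅` that occurs in `edgeLists`. -/
abbrev edgesC5 : List (Fin 5 × Fin 5) := [(0, 1), (0, 2), (1, 3), (2, 4), (3, 4)]

/-- The edge list of `K₄ ∪ K₁` that occurs in `edgeLists`. -/
abbrev edgesK4K1 : List (Fin 5 × Fin 5) :=
  [(0, 1), (0, 2), (0, 3), (1, 2), (1, 3), (2, 3)]

/-- The edge list of `K₂ ∪ K₂ ∪ K₁` that occurs in `edgeLists`. -/
abbrev edgesK2K2K1 : List (Fin 5 × Fin 5) := [(0, 1), (2, 3)]

set_option synthInstance.maxSize 4000 in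
set_option synthInstance.maxHeartbeats 400000 in
/-- The bounds separate the local energies of any two listed graphs, except inside the two groups
named in the conclusion. -/
theorem localEnergy_bounds_separate : ∀ l ∈ edgeLists, ∀ l' ∈ edgeLists, l = l' ∨
    localEnergyUpper l < localEnergyLower l' ∨ localEnergyUpper l' < localEnergyLower l ∨
    (l ∈ [edgesK5, edgesK3K2, edgesC5] ∧ l' ∈ [edgesK5, edgesK3K2, edgesC5]) ∨
    (l ∈ [edgesK4K1, edgesK2K2K1] ∧ l' ∈ [edgesK4K1, edgesK2K2K1]) := by
  decide +kernel

/-! ### The polynomial of a coefficient list -/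

/-- The real polynomial with the given coefficients, constant term first. -/
noncomputable def toPoly : List ℤ → ℝ[X]
  | [] => 0
  | a :: p => C (a : ℝ) + X * toPoly p

theorem toPoly_addCoeffs (p q : List ℤ) : toPoly (addCoeffs p q) = toPoly p + toPoly q := by
  induction p generalizing q with
  | nil => simp [addCoeffs, toPoly]
  | cons a p ih =>
    cases q with
    | nil => simp [addCoeffs, toPoly]
    | cons b q =>
      simp only [addCoeffs, toPoly, ih, Int.cast_add, map_add]
      ring

theorem toPoly_map_mul (a : ℤ) (q : List ℤ) :
    toPoly (q.map (a * ·)) = C (a : ℝ) * toPoly q := by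
  induction q with
  | nil => simp [toPoly]
  | cons b q ih =>
    simp only [List.map_cons, toPoly, ih, Int.cast_mul, map_mul]
    ring

theorem toPoly_mulCoeffs (p q : List ℤ) : toPoly (mulCoeffs p q) = toPoly p * toPoly q := by
  induction p with
  | nil => simp [mulCoeffs, toPoly]
  | cons a p ih =>
    simp only [mulCoeffs, toPoly_addCoeffs, toPoly_map_mul, toPoly, ih, Int.cast_zero, map_zero]
    ring

theorem toPoly_foldr_mulCoeffs (L : List (List ℤ)) :
    toPoly (L.foldr mulCoeffs [1]) = (L.map toPoly).prod := by
  induction L with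
  | nil => simp [toPoly]
  | cons p L ih => simp [toPoly_mulCoeffs, ih]

theorem coeff_toPoly (l : List ℤ) (n : ℕ) : (toPoly l).coeff n = (l.getD n 0 : ℤ) := by
  induction l generalizing n with
  | nil => simp [toPoly]
  | cons a p ih =>
    cases n with
    | zero => simp [toPoly]
    | succ n => simp only [toPoly, coeff_add, coeff_C_succ, coeff_X_mul, zero_add, ih,
        List.getD_cons_succ]

theorem natDegree_toPoly_lt {l : List ℤ} (h : l ≠ []) : (toPoly l).natDegree < l.length := by
  have hl := List.length_pos_of_ne_nil h
  have : (toPoly l).natDegree ≤ l.length - 1 := by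
    rw [natDegree_le_iff_coeff_eq_zero]
    intro n hn
    rw [coeff_toPoly, List.getD_eq_default _ _ (by omega), Int.cast_zero]
  omega

theorem homEval_mul_eq (m : ℤ) {N : ℤ} (hN : N ≠ 0) (l : List ℤ) :
    (homEval m N l : ℝ) * N = N ^ l.length * (toPoly l).eval (m / N : ℝ) := by
  have hN' : (N : ℝ) ≠ 0 := by exact_mod_cast hN
  induction l with
  | nil => simp [homEval, toPoly]
  | cons a p ih =>
    simp only [homEval, toPoly, List.length_cons, eval_add, eval_C, eval_mul, eval_X]
    push_cast
    rw [add_mul, mul_assoc (m : ℝ), ih]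
    field_simp
    ring

theorem exists_root_of_homEval {l : List ℤ} {m k N : ℤ} (hN : 0 < N) (hmk : m ≤ k)
    (h : homEval m N l * homEval k N l ≤ 0) :
    ∃ x ∈ Set.Icc (m / N : ℝ) (k / N), (toPoly l).IsRoot x := by
  have hN' : (0 : ℝ) < N := by exact_mod_cast hN
  have hle : (m / N : ℝ) ≤ k / N := by gcongr
  have hprod : (toPoly l).eval (m / N : ℝ) * (toPoly l).eval (k / N : ℝ) ≤ 0 := by
    have h1 := homEval_mul_eq m hN.ne' l
    have h2 := homEval_mul_eq k hN.ne' l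
    have h3 : (homEval m N l : ℝ) * homEval k N l ≤ 0 := by exact_mod_cast h
    have hpow : (0 : ℝ) < (N ^ l.length) * (N ^ l.length) := by positivity
    by_contra! hcon
    have h4 := mul_pos hpow hcon
    have h5 : ((N : ℝ) ^ l.length * N ^ l.length) *
        ((toPoly l).eval (m / N : ℝ) * (toPoly l).eval (k / N : ℝ)) =
        (homEval m N l * homEval k N l) * (N * N) := by
      linear_combination -(homEval k N l * (N : ℝ)) * h1 -
        (N : ℝ) ^ l.length * (toPoly l).eval (m / N : ℝ) * h2
    have h6 : (0 : ℝ) < N * N := by positivity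
    linarith [mul_nonpos_of_nonpos_of_nonneg h3 h6.le]
  have hc : ContinuousOn (fun x => (toPoly l).eval x) (Set.Icc (m / N : ℝ) (k / N)) :=
    (toPoly l).continuous.continuousOn
  rcases mul_nonpos_iff.1 hprod with ⟨h1, h2⟩ | ⟨h1, h2⟩
  · exact intermediate_value_Icc' hle hc ⟨h2, h1⟩
  · exact intermediate_value_Icc hle hc ⟨h1, h2⟩

/-! ### Sums of absolute values of roots -/

namespace IsolatedFactor

/-- The sum of the absolute values of the real roots, with multiplicity. -/
noncomputable def absRootSum (f : IsolatedFactor) : ℝ :=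
  ((toPoly f.coeffs).roots.map fun x => |x|).sum

theorem Valid.toPoly_ne_zero {f : IsolatedFactor} (hf : f.Valid) : toPoly f.coeffs ≠ 0 := by
  intro h
  have h1 := coeff_toPoly f.coeffs f.brackets.length
  rw [h, coeff_zero] at h1
  exact hf.2.1 (by exact_mod_cast h1.symm)

/-- The roots are exactly the ones found in the brackets: those are distinct, since the brackets are
disjoint, and they are as many as the degree. -/
theorem Valid.exists_roots_eq {f : IsolatedFactor} (hf : f.Valid) :
    ∃ r : ℤ × ℤ → ℝ, (∀ b ∈ f.brackets, r b ∈ Set.Icc (b.1 / scale : ℝ) (b.2 / scale)) ∧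
      (toPoly f.coeffs).roots = (f.brackets.map r : List ℝ) := by
  have hne := hf.toPoly_ne_zero
  obtain ⟨hlen, -, hpw, hb⟩ := hf
  have hex : ∀ b : ℤ × ℤ, ∃ x : ℝ, b ∈ f.brackets →
      x ∈ Set.Icc (b.1 / scale : ℝ) (b.2 / scale) ∧ (toPoly f.coeffs).IsRoot x := by
    intro b
    by_cases h : b ∈ f.brackets
    · obtain ⟨x, hx⟩ := exists_root_of_homEval (by norm_num) (hb b h).1 (hb b h).2
      exact ⟨x, fun _ => hx⟩
    · exact ⟨0, fun h' => absurd h' h⟩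
  choose r hr using hex
  refine ⟨r, fun b h => (hr b h).1, ?_⟩
  have hnodup : (f.brackets.map r).Nodup := by
    rw [List.Nodup, List.pairwise_map]
    refine hpw.imp_of_mem fun {b c} hbm hcm hbc => ne_of_lt ?_
    calc r b ≤ b.2 / scale := (hr b hbm).1.2
      _ < c.1 / scale := by
        have : (b.2 : ℝ) < c.1 := by exact_mod_cast hbc
        gcongr
      _ ≤ r c := (hr c hcm).1.1
  symm
  refine Multiset.eq_of_le_of_card_le
    ((Multiset.le_iff_subset (Multiset.coe_nodup.2 hnodup)).2 ?_) ?_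
  · intro x hx
    obtain ⟨b, hbm, rfl⟩ := List.mem_map.1 (Multiset.mem_coe.1 hx)
    exact (mem_roots hne).2 (hr b hbm).2
  · have h1 := card_roots' (toPoly f.coeffs)
    have h2 := natDegree_toPoly_lt (l := f.coeffs) (by rintro h; simp [h] at hlen)
    simp only [Multiset.coe_card, List.length_map]
    omega

theorem Valid.absRootSum_mem {f : IsolatedFactor} (hf : f.Valid) :
    scale * f.absRootSum ∈ Set.Icc (f.lower : ℝ) f.upper := by
  obtain ⟨r, hr, hroots⟩ := hf.exists_roots_eq
  have hsum : scale * f.absRootSum = (f.brackets.map fun b => scale * |r b|).sum := by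
    rw [absRootSum, hroots, Multiset.map_coe, Multiset.sum_coe, List.map_map,
      ← List.sum_map_mul_left]
    rfl
  have hs : (0 : ℝ) < scale := by norm_num
  have key : ∀ b ∈ f.brackets, (b.1 : ℝ) ≤ scale * r b ∧ scale * r b ≤ b.2 := by
    intro b hb
    have := hr b hb
    exact ⟨(div_le_iff₀' hs).1 this.1, (le_div_iff₀' hs).1 this.2⟩
  have habs : ∀ x : ℝ, (scale : ℝ) * |x| = |scale * x| := fun x => by
    rw [abs_mul, abs_of_pos hs]
  rw [hsum]
  constructor
  · rw [lower, Int.cast_list_sum, List.map_map]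
    refine List.sum_le_sum fun b hb => ?_
    obtain ⟨h1, h2⟩ := key b hb
    simp only [Function.comp, habs]
    push_cast
    exact max_le (h1.trans (le_abs_self _)) ((neg_le_neg h2).trans (neg_le_abs _))
  · rw [upper, Int.cast_list_sum, List.map_map]
    refine List.sum_le_sum fun b hb => ?_
    obtain ⟨h1, h2⟩ := key b hb
    simp only [Function.comp, habs]
    push_cast
    exact abs_le'.2 ⟨h2.trans (le_max_right _ _), (neg_le_neg h1).trans (le_max_left _ _)⟩

end IsolatedFactor

/-! ### Energies and local energies from the table -/

theorem charpoly_eq_toPoly (a : Fin 5 → Fin 5 → ℤ) (hsymm : ∀ i j, a i j = a j i)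
    (hdiag : ∀ i, a i i = 0) :
    (Matrix.of fun i j => (a i j : ℝ)).charpoly = toPoly (symmCharCoeffs a) := by
  have h2 : (C 2 : ℝ[X]) = 2 := rfl
  rw [Matrix.charpoly, Matrix.det_succ_row_zero]
  simp [h2, Matrix.det_succ_row_zero, Fin.sum_univ_succ, Matrix.charmatrix_apply, Fin.succAbove,
    toPoly, symmCharCoeffs, hdiag, hsymm 1 0, hsymm 2 0, hsymm 2 1, hsymm 3 0, hsymm 3 1,
    hsymm 3 2, hsymm 4 0, hsymm 4 1, hsymm 4 2, hsymm 4 3]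
  ring

/-- The form of `energy_eq_roots` for arbitrary decidability instances. -/
theorem energy_eq_sum_abs_roots {V : Type*} [Fintype V] [DecidableEq V] (G : SimpleGraph V)
    [DecidableRel G.Adj] :
    G.energy = ((G.adjMatrix ℝ).charpoly.roots.map fun x => |x|).sum := by
  rw [energy_eq_roots]
  congr!

/-- Deleting an isolated vertex does not change the energy, as the vertex only contributes the
eigenvalue `0`. -/
theorem energy_eq_energy_induce_of_isolated {V : Type*} [Fintype V] [DecidableEq V]
    (G : SimpleGraph V) (v : V)
    (hv : ∀ w, ¬ G.Adj v w) : G.energy = (G.induce {w : V | w ≠ v}).energy := by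
  classical
  set H := G.induce {w : V | w ≠ v}
  rw [energy_eq_sum_abs_roots, energy_eq_sum_abs_roots]
  let Z : Matrix {w : V // ¬ w ≠ v} {w : V // ¬ w ≠ v} ℝ := 0
  have hG : G.adjMatrix ℝ = Matrix.reindex (Equiv.sumCompl fun w : V => w ≠ v)
      (Equiv.sumCompl fun w : V => w ≠ v) (Matrix.fromBlocks (H.adjMatrix ℝ) 0 0 Z) := by
    rw [← Equiv.symm_apply_eq]
    ext (i | i) (j | j)
    · simp [H, adjMatrix_apply]
    · have hj : (j : V) = v := not_not.1 j.2
      simp [adjMatrix_apply, hj, G.adj_comm _ v, hv]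
    · have hi : (i : V) = v := not_not.1 i.2
      simp [adjMatrix_apply, hi, hv]
    · have hi : (i : V) = v := not_not.1 i.2
      simp [adjMatrix_apply, hi, hv, Z]
  have hZ : Z.charpoly = X ^ Fintype.card {w : V // ¬ w ≠ v} := Matrix.charpoly_zero
  rw [hG, Matrix.charpoly_reindex, Matrix.charpoly_fromBlocks_zero₁₂, hZ, roots_mul
    (mul_ne_zero (Matrix.charpoly_monic _).ne_zero (pow_ne_zero _ X_ne_zero)), roots_X_pow]
  rw [Multiset.map_add, Multiset.sum_add, Multiset.map_nsmul, Multiset.sum_nsmul,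
    Multiset.map_singleton, Multiset.sum_singleton, abs_zero, smul_zero, add_zero]

theorem ofEdges_deleteVertex_adj (l : List (Fin 5 × Fin 5)) (v i j : Fin 5) :
    (ofEdges (deleteVertex l v)).Adj i j ↔ (ofEdges l).Adj i j ∧ i ≠ v ∧ j ≠ v := by
  simp only [ofEdges, deleteVertex, fromRel_adj, List.mem_filter, decide_eq_true_eq]
  tauto

theorem energy_induce_ofEdges (l : List (Fin 5 × Fin 5)) (v : Fin 5) :
    ((ofEdges l).induce {w : Fin 5 | w ≠ v}).energy = (ofEdges (deleteVertex l v)).energy := by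
  have h : (ofEdges l).induce {w : Fin 5 | w ≠ v} =
      (ofEdges (deleteVertex l v)).induce {w : Fin 5 | w ≠ v} := by
    ext ⟨i, hi⟩ ⟨j, hj⟩
    exact ((ofEdges_deleteVertex_adj l v i j).trans (and_iff_left ⟨hi, hj⟩)).symm
  rw [h, energy_eq_energy_induce_of_isolated (ofEdges (deleteVertex l v)) v
    fun w hw => ((ofEdges_deleteVertex_adj l v v w).1 hw).2.1 rfl]

theorem localEnergy_ofEdges (l : List (Fin 5 × Fin 5)) : (ofEdges l).localEnergy =
    ((List.finRange 5).map fun v =>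
      (ofEdges l).energy - (ofEdges (deleteVertex l v)).energy).sum := by
  rw [localEnergy, ← Fin.sum_univ_def]
  refine Finset.sum_congr rfl fun v _ => ?_
  unfold localEnergyAt
  rw [← energy_induce_ofEdges]
  convert rfl

theorem charpoly_ofEdges (l : List (Fin 5 × Fin 5)) :
    ((ofEdges l).adjMatrix ℝ).charpoly = toPoly (charCoeffs l) := by
  rw [charCoeffs, ← charpoly_eq_toPoly]
  · congr 1
    ext i j
    simp [adjMatrix_apply]
  · intro i j
    simp [adj_comm]
  · simp

theorem mem_of_lookup_eq_some {α β : Type*} [BEq α] [LawfulBEq α] {k : α} {b : β}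
    {t : List (α × β)} (h : t.lookup k = some b) : (k, b) ∈ t := by
  obtain ⟨l₁, l₂, rfl, -⟩ := List.lookup_eq_some_iff.1 h
  simp

theorem energy_ofEdges {l : List (Fin 5 × Fin 5)}
    (hl : charpolyTable.lookup (charCoeffs l) ≠ none) :
    (∀ f ∈ charFactors l, f.Valid) ∧
      (ofEdges l).energy = ((charFactors l).map IsolatedFactor.absRootSum).sum := by
  obtain ⟨F, hF⟩ := Option.ne_none_iff_exists'.1 hl
  obtain ⟨hprod, hvalid⟩ := charpolyTable_valid _ (mem_of_lookup_eq_some hF)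
  have hF' : charFactors l = F := by rw [charFactors, hF, Option.getD_some]
  simp only at hprod hvalid
  rw [hF']
  refine ⟨hvalid, ?_⟩
  rw [energy_eq_sum_abs_roots, charpoly_ofEdges, ← hprod, toPoly_foldr_mulCoeffs, roots_list_prod]
  · rw [Multiset.map_bind, Multiset.sum_bind]
    simp [Function.comp_def]
    rfl
  · simp only [List.map_map, List.mem_map, not_exists, not_and]
    exact fun f hf => (hvalid f hf).toPoly_ne_zero

open IsolatedFactor in
theorem energy_ofEdges_mem {l : List (Fin 5 × Fin 5)}
    (hl : charpolyTable.lookup (charCoeffs l) ≠ none) :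
    scale * (ofEdges l).energy ∈ Set.Icc (energyLower l : ℝ) (energyUpper l) := by
  obtain ⟨hvalid, henergy⟩ := energy_ofEdges hl
  rw [henergy, ← List.sum_map_mul_left, energyLower, energyUpper, Int.cast_list_sum,
    Int.cast_list_sum, List.map_map, List.map_map]
  exact ⟨List.sum_le_sum fun f hf => (hvalid f hf).absRootSum_mem.1,
    List.sum_le_sum fun f hf => (hvalid f hf).absRootSum_mem.2⟩

open IsolatedFactor in
theorem localEnergy_ofEdges_mem {l : List (Fin 5 × Fin 5)} (hl : l ∈ edgeLists) :
    scale * (ofEdges l).localEnergy ∈ Set.Icc (localEnergyLower l : ℝ) (localEnergyUpper l) := by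
  obtain ⟨h, h'⟩ := lookup_charCoeffs_ne_none l hl
  rw [localEnergy_ofEdges, ← List.sum_map_mul_left, localEnergyLower, localEnergyUpper,
    Int.cast_list_sum, Int.cast_list_sum, List.map_map, List.map_map]
  have h1 := energy_ofEdges_mem h
  have h2 := fun v => energy_ofEdges_mem (h' v)
  constructor <;> refine List.sum_le_sum fun v _ => ?_ <;> simp only [Function.comp, mul_sub] <;>
    push_cast
  · exact sub_le_sub h1.1 (h2 v).2
  · exact sub_le_sub h1.2 (h2 v).1

/-! ### Classification of the graphs of order 5 -/

theorem IsoSearch.nonempty_iso {G H : SimpleGraph (Fin 5)} (h : IsoSearch G H) :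
    Nonempty (G ≃g H) := by
  obtain ⟨a, b, ⟨hba, b₁⟩, c, ⟨hca, hcb, c₁, c₂⟩, d, ⟨hda, hdb, hdc, d₁, d₂, d₃⟩,
    e, hea, heb, hec, hed, e₁, e₂, e₃, e₄⟩ := h
  have hlt : ∀ i j : Fin 5, i < j → ![a, b, c, d, e] j ≠ ![a, b, c, d, e] i ∧
      (H.Adj (![a, b, c, d, e] i) (![a, b, c, d, e] j) ↔ G.Adj i j) := by
    intro i j hij
    fin_cases i <;> fin_cases j <;> first | exact absurd hij (by decide) | exact ⟨‹_›, ‹_›⟩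
  have hinj : Function.Injective ![a, b, c, d, e] := by
    intro i j hij
    rcases lt_trichotomy i j with h | h | h
    · exact absurd hij.symm (hlt i j h).1
    · exact h
    · exact absurd hij (hlt j i h).1
  refine ⟨⟨Equiv.ofBijective _ (Finite.injective_iff_bijective.1 hinj), fun {i j} => ?_⟩⟩
  simp only [Equiv.ofBijective_apply]
  rcases lt_trichotomy i j with h | rfl | h
  · exact (hlt i j h).2
  · simp
  · rw [H.adj_comm, G.adj_comm]
    exact (hlt j i h).2

theorem ofEdges_cons_adj (a b : Fin 5) (l : List (Fin 5 × Fin 5)) (i j : Fin 5) :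
    (ofEdges ((a, b) :: l)).Adj i j ↔
      (ofEdges l).Adj i j ∨ i ≠ j ∧ (i = a ∧ j = b ∨ i = b ∧ j = a) := by
  simp only [ofEdges, fromRel_adj, List.mem_cons, Prod.mk.injEq]
  tauto

theorem exists_iso_cons_of_mem {l : List (Fin 5 × Fin 5)} (hl : l ∈ edgeLists) (a b : Fin 5) :
    ∃ l' ∈ edgeLists, Nonempty (ofEdges ((a, b) :: l) ≃g ofEdges l') := by
  have hlt : ∀ i j, i < j → ∃ l' ∈ edgeLists, Nonempty (ofEdges ((i, j) :: l) ≃g ofEdges l') := by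
    intro i j hij
    by_cases hmem : (i, j) ∈ l
    · have h : ofEdges ((i, j) :: l) = ofEdges l := by
        simp only [ofEdges, List.mem_cons]
        ext x y
        simp only [fromRel_adj]
        grind
      exact ⟨l, hl, ⟨h ▸ Iso.refl⟩⟩
    · obtain ⟨l', hl', -, -, hiso⟩ := exists_isoSearch_cons l hl j i hij hmem
      exact ⟨l', hl', hiso.nonempty_iso⟩
  rcases lt_trichotomy a b with h | rfl | h
  · exact hlt a b h
  · have h : ofEdges ((a, a) :: l) = ofEdges l := by
      ext i j
      rw [ofEdges_cons_adj]
      grind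
    exact ⟨l, hl, ⟨h ▸ Iso.refl⟩⟩
  · have h' : ofEdges ((a, b) :: l) = ofEdges ((b, a) :: l) := by
      ext i j
      rw [ofEdges_cons_adj, ofEdges_cons_adj]
      tauto
    rw [h']
    exact hlt b a h

/-- Adding the edges one at a time, the graph stays isomorphic to a listed one. -/
theorem exists_iso_ofEdges_of_list (l : List (Fin 5 × Fin 5)) :
    ∃ l' ∈ edgeLists, Nonempty (ofEdges l ≃g ofEdges l') := by
  induction l with
  | nil => exact ⟨[], by decide, ⟨Iso.refl⟩⟩
  | cons e l ih =>
    obtain ⟨l', hl', ⟨f⟩⟩ := ih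
    obtain ⟨l'', hl'', ⟨g⟩⟩ := exists_iso_cons_of_mem hl' (f e.1) (f e.2)
    refine ⟨l'', hl'', ⟨RelIso.trans ⟨f.toEquiv, fun {i j} => ?_⟩ g⟩⟩
    rw [← Prod.mk.eta (p := e), ofEdges_cons_adj, ofEdges_cons_adj]
    simp [f.map_adj_iff, f.injective.eq_iff]

theorem exists_iso_ofEdges (G : SimpleGraph (Fin 5)) :
    ∃ l ∈ edgeLists, Nonempty (G ≃g ofEdges l) := by
  classical
  have h : G = ofEdges ((Finset.univ.filter fun e : Fin 5 × Fin 5 => G.Adj e.1 e.2).toList) := by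
    ext i j
    simp only [ofEdges, fromRel_adj, Finset.mem_toList, Finset.mem_filter, Finset.mem_univ,
      true_and]
    exact ⟨fun h => ⟨h.ne, .inl h⟩, fun h => h.2.elim id fun h => h.symm⟩
  rw [h]
  exact exists_iso_ofEdges_of_list _

/-! ### The exact local energy of the 5-cycle -/

namespace IsolatedFactor

theorem absRootSum_lin (a : ℤ) : (lin a).absRootSum = |(a : ℝ)| := by
  have h : toPoly (lin a).coeffs = X - C (a : ℝ) := by
    simp [lin, toPoly]
    ring
  rw [absRootSum, h, roots_X_sub_C]
  simp

theorem absRootSum_eq_of_comp_neg_X {f g : IsolatedFactor}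
    (h : toPoly g.coeffs = (toPoly f.coeffs).comp (-X)) : g.absRootSum = f.absRootSum := by
  rw [absRootSum, absRootSum, h, roots_comp_neg_X, Multiset.map_map]
  simp

end IsolatedFactor

open IsolatedFactor in
/-- The characteristic polynomial of `C₅` is `(X - 2) (X² + X - 1)²`, that of its vertex-deleted
subgraph `P₄`, completed by an isolated vertex, is `X (X² + X - 1) (X² - X - 1)`, and the two
quadratics have opposite roots. If these have absolute sum `s`, the local energy is
`5 ((2 + 2 s) - 2 s) = 10`. -/
theorem localEnergy_edgesC5 : (ofEdges edgesC5).localEnergy = 10 := by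
  obtain ⟨h, h'⟩ := lookup_charCoeffs_ne_none edgesC5 (by decide)
  have hC : charFactors edgesC5 = [lin 2, isolated [-1, 1, 1] [-161804, 61803],
      isolated [-1, 1, 1] [-161804, 61803]] := by rfl
  have hP : ∀ v, charFactors (deleteVertex edgesC5 v) = [lin 0,
      isolated [-1, 1, 1] [-161804, 61803],
      isolated [-1, -1, 1] [-61804, 161803]] := by
    intro v
    fin_cases v <;> rfl
  have hneg : (isolated [-1, -1, 1] [-61804, 161803]).absRootSum =
      (isolated [-1, 1, 1] [-161804, 61803]).absRootSum := by
    apply absRootSum_eq_of_comp_neg_X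
    simp [isolated, toPoly]
    ring
  rw [localEnergy_ofEdges, ← Fin.sum_univ_def]
  simp only [(energy_ofEdges h).2, (energy_ofEdges (h' _)).2, hC, hP, List.map_cons, List.map_nil,
    List.sum_cons, List.sum_nil, absRootSum_lin, hneg, Finset.sum_const,
    Finset.card_univ, Fintype.card_fin]
  norm_num

/-! ### Isomorphism types and the classes -/

/-- The isomorphism type of `ofEdges l`. -/
noncomputable def typeOfEdges (l : List (Fin 5 × Fin 5)) : GraphOfOrder 5 :=
  Quotient.mk (isoSetoid 5) (ofEdges l)

/-- The local energy of an isomorphism type. -/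
noncomputable def GraphOfOrder.localEnergy {n : ℕ} (x : GraphOfOrder n) : ℝ :=
  Quotient.lift (s := isoSetoid n) SimpleGraph.localEnergy
    (fun _ _ ⟨f⟩ => localEnergy_congr f) x

theorem locallyEquienergeticSetoid_iff {n : ℕ} (x y : GraphOfOrder n) :
    locallyEquienergeticSetoid n x y ↔ x.localEnergy = y.localEnergy := by
  induction x using Quotient.inductionOn
  induction y using Quotient.inductionOn
  exact and_iff_right rfl

theorem exists_typeOfEdges_eq (x : GraphOfOrder 5) : ∃ l ∈ edgeLists, typeOfEdges l = x := by
  induction x using Quotient.inductionOn with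
  | h G =>
    obtain ⟨l, hl, ⟨f⟩⟩ := exists_iso_ofEdges G
    exact ⟨l, hl, Quotient.sound (s := isoSetoid 5) ⟨f.symm⟩⟩

theorem isoType_eq_typeOfEdges {V : Type*} [Fintype V] (G : SimpleGraph V)
    (h : Fintype.card V = 5) {l : List (Fin 5 × Fin 5)} (e : V ≃ Fin 5)
    (he : ∀ v w, (ofEdges l).Adj (e v) (e w) ↔ G.Adj v w) : isoType G h = typeOfEdges l :=
  Quotient.sound (s := isoSetoid 5) ⟨(G.overFinIso h).symm.trans ⟨e, he _ _⟩⟩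

instance {V W : Type*} (G : SimpleGraph V) (H : SimpleGraph W) [DecidableRel G.Adj]
    [DecidableRel H.Adj] : DecidableRel (G ⊕g H).Adj
  | .inl v, .inl w => inferInstanceAs (Decidable (G.Adj v w))
  | .inr v, .inr w => inferInstanceAs (Decidable (H.Adj v w))
  | .inl _, .inr _ => .isFalse nofun
  | .inr _, .inl _ => .isFalse nofun

theorem isoType_K5 : isoType (completeGraph (Fin 5)) (by simp) = typeOfEdges edgesK5 :=
  isoType_eq_typeOfEdges _ _ (Equiv.refl _) (by decide)

theorem isoType_K3K2 : isoType (completeGraph (Fin 3) ⊕g completeGraph (Fin 2)) (by simp) =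
    typeOfEdges edgesK3K2 :=
  isoType_eq_typeOfEdges _ _ finSumFinEquiv (by decide)

theorem isoType_C5 : isoType (cycleGraph 5) (by simp) = typeOfEdges edgesC5 := by
  -- The 5-cycle of `edgesC5` visits the vertices in the order `0, 1, 3, 4, 2`.
  refine isoType_eq_typeOfEdges _ _
    ⟨![0, 1, 3, 4, 2], ![0, 1, 4, 2, 3], by decide, by decide⟩ ?_
  simp only [cycleGraph_adj]
  decide

theorem isoType_K4K1 : isoType (completeGraph (Fin 4) ⊕g completeGraph (Fin 1)) (by simp) =
    typeOfEdges edgesK4K1 :=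
  isoType_eq_typeOfEdges _ _ finSumFinEquiv (by decide)

theorem isoType_K2K2K1 :
    isoType ((completeGraph (Fin 2) ⊕g completeGraph (Fin 2)) ⊕g completeGraph (Fin 1))
      (by simp) = typeOfEdges edgesK2K2K1 :=
  isoType_eq_typeOfEdges _ _ ((Equiv.sumCongr finSumFinEquiv (Equiv.refl _)).trans finSumFinEquiv)
    (by decide)

theorem typeOfEdges_ne_of_energy_lt {l l' : List (Fin 5 × Fin 5)} (hl : l ∈ edgeLists)
    (hl' : l' ∈ edgeLists) (h : energyUpper l < energyLower l') :
    typeOfEdges l ≠ typeOfEdges l' := by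
  intro heq
  obtain ⟨f⟩ := Quotient.exact (s := isoSetoid 5) heq
  have h1 := (energy_ofEdges_mem (lookup_charCoeffs_ne_none l hl).1).2
  have h2 := (energy_ofEdges_mem (lookup_charCoeffs_ne_none l' hl').1).1
  rw [energy_congr f] at h1
  have h3 : (energyUpper l : ℝ) < energyLower l' := by exact_mod_cast h
  linarith

theorem localEnergy_typeOfEdges_of_bounds_eq {l : List (Fin 5 × Fin 5)} (hl : l ∈ edgeLists) {k : ℤ}
    (h1 : localEnergyLower l = IsolatedFactor.scale * k)
    (h2 : localEnergyUpper l = IsolatedFactor.scale * k) :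
    (typeOfEdges l).localEnergy = k := by
  have h := localEnergy_ofEdges_mem hl
  rw [h1, h2, Set.Icc_self, Set.mem_singleton_iff] at h
  push_cast at h
  exact mul_left_cancel₀ (by norm_num) h

/-- The isomorphism types of `K₅`, `K₃ ∪ K₂` and `C₅`, which turn out to be those of local
energy 10. -/
def classTen : Set (GraphOfOrder 5) :=
  {typeOfEdges edgesK5, typeOfEdges edgesK3K2, typeOfEdges edgesC5}

/-- The isomorphism types of `K₄ ∪ K₁` and `K₂ ∪ K₂ ∪ K₁`, which turn out to be those of local
energy 8. -/
def classEight : Set (GraphOfOrder 5) :=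
  {typeOfEdges edgesK4K1, typeOfEdges edgesK2K2K1}

theorem localEnergy_of_mem_classTen {x : GraphOfOrder 5} (hx : x ∈ classTen) :
    x.localEnergy = 10 := by
  rcases hx with rfl | rfl | rfl
  · exact_mod_cast localEnergy_typeOfEdges_of_bounds_eq (k := 10) (by decide)
      (by decide +kernel) (by decide +kernel)
  · exact_mod_cast localEnergy_typeOfEdges_of_bounds_eq (k := 10) (by decide)
      (by decide +kernel) (by decide +kernel)
  · exact localEnergy_edgesC5

theorem localEnergy_of_mem_classEight {x : GraphOfOrder 5} (hx : x ∈ classEight) :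
    x.localEnergy = 8 := by
  rcases hx with rfl | rfl
  · exact_mod_cast localEnergy_typeOfEdges_of_bounds_eq (k := 8) (by decide)
      (by decide +kernel) (by decide +kernel)
  · exact_mod_cast localEnergy_typeOfEdges_of_bounds_eq (k := 8) (by decide)
      (by decide +kernel) (by decide +kernel)

theorem mem_classes_of_localEnergy_eq {x y : GraphOfOrder 5} (hxy : x ≠ y)
    (h : x.localEnergy = y.localEnergy) :
    x ∈ classTen ∧ y ∈ classTen ∨ x ∈ classEight ∧ y ∈ classEight := by
  obtain ⟨l, hl, rfl⟩ := exists_typeOfEdges_eq x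
  obtain ⟨l', hl', rfl⟩ := exists_typeOfEdges_eq y
  have h1 := localEnergy_ofEdges_mem hl
  have h2 := localEnergy_ofEdges_mem hl'
  rw [show (ofEdges l).localEnergy = (ofEdges l').localEnergy from h] at h1
  have hmem : ∀ {l} {L : List (List (Fin 5 × Fin 5))}, l ∈ L →
      typeOfEdges l ∈ {x | x ∈ L.map typeOfEdges} := fun h => List.mem_map_of_mem h
  rcases localEnergy_bounds_separate l hl l' hl' with rfl | hlt | hlt | ⟨hA, hA'⟩ | ⟨hB, hB'⟩
  · exact absurd rfl hxy
  · have : (localEnergyUpper l : ℝ) < localEnergyLower l' := by exact_mod_cast hlt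
    linarith [h1.2, h2.1]
  · have : (localEnergyUpper l' : ℝ) < localEnergyLower l := by exact_mod_cast hlt
    linarith [h1.1, h2.2]
  · left
    simpa [classTen] using And.intro (hmem hA) (hmem hA')
  · right
    simpa [classEight] using And.intro (hmem hB) (hmem hB')

theorem classTen_eq : classTen = {x | x.localEnergy = 10} := by
  refine Set.Subset.antisymm (fun x hx => localEnergy_of_mem_classTen hx) fun y hy => ?_
  have hK : typeOfEdges edgesK5 ∈ classTen := by simp [classTen]
  by_cases hxy : typeOfEdges edgesK5 = y
  · exact hxy ▸ hK
  · rcases mem_classes_of_localEnergy_eq hxy ((localEnergy_of_mem_classTen hK).trans hy.symm)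
      with h | h
    · exact h.2
    · have := (localEnergy_of_mem_classEight h.2).symm.trans hy
      norm_num at this

theorem classEight_eq : classEight = {x | x.localEnergy = 8} := by
  refine Set.Subset.antisymm (fun x hx => localEnergy_of_mem_classEight hx) fun y hy => ?_
  have hK : typeOfEdges edgesK4K1 ∈ classEight := by simp [classEight]
  by_cases hxy : typeOfEdges edgesK4K1 = y
  · exact hxy ▸ hK
  · rcases mem_classes_of_localEnergy_eq hxy ((localEnergy_of_mem_classEight hK).trans hy.symm)
      with h | h
    · have := (localEnergy_of_mem_classTen h.2).symm.trans hy
      norm_num at this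
    · exact h.2

theorem ncard_classTen : classTen.ncard = 3 :=
  Set.ncard_eq_three.2 ⟨_, _, _,
    (typeOfEdges_ne_of_energy_lt (by decide) (by decide) (by decide +kernel)).symm,
    (typeOfEdges_ne_of_energy_lt (by decide) (by decide) (by decide +kernel)).symm,
    typeOfEdges_ne_of_energy_lt (by decide) (by decide) (by decide +kernel), rfl⟩

theorem ncard_classEight : classEight.ncard = 2 :=
  Set.ncard_pair (typeOfEdges_ne_of_energy_lt (by decide) (by decide) (by decide +kernel)).symm

/-- The classes are the level sets of the local energy with at least two elements. -/
theorem mem_locallyEquienergeticClasses_iff {n : ℕ} {S : Set (GraphOfOrder n)} :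
    S ∈ locallyEquienergeticClasses n ↔ (∃ E : ℝ, S = {x | x.localEnergy = E}) ∧ S.Nontrivial := by
  refine and_congr_left fun hS => ⟨?_, ?_⟩
  · rintro ⟨y, rfl⟩
    exact ⟨y.localEnergy, Set.ext fun x => locallyEquienergeticSetoid_iff x y⟩
  · rintro ⟨E, rfl⟩
    obtain ⟨y, rfl⟩ := hS.nonempty
    exact ⟨y, Set.ext fun x => (locallyEquienergeticSetoid_iff x y).symm⟩

theorem locallyEquienergeticClasses_five :
    locallyEquienergeticClasses 5 = {classTen, classEight} := by
  ext S
  rw [mem_locallyEquienergeticClasses_iff]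
  constructor
  · rintro ⟨⟨E, rfl⟩, x, hx, y, hy, hxy⟩
    rcases mem_classes_of_localEnergy_eq hxy (hx.trans hy.symm) with ⟨h, -⟩ | ⟨h, -⟩
    · left
      rw [classTen_eq, ← hx, localEnergy_of_mem_classTen h]
    · right
      rw [Set.mem_singleton_iff, classEight_eq, ← hx, localEnergy_of_mem_classEight h]
  · rintro (rfl | rfl)
    · exact ⟨⟨10, classTen_eq⟩, (Set.one_lt_ncard_iff_nontrivial_and_finite.1
        (by rw [ncard_classTen]; norm_num)).1⟩
    · exact ⟨⟨8, classEight_eq⟩, (Set.one_lt_ncard_iff_nontrivial_and_finite.1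
        (by rw [ncard_classEight]; norm_num)).1⟩

theorem classTen_ne_classEight : classTen ≠ classEight := by
  intro h
  have hK : typeOfEdges edgesK5 ∈ classTen := by simp [classTen]
  have := (localEnergy_of_mem_classTen hK).symm.trans (localEnergy_of_mem_classEight (h ▸ hK))
  norm_num at this

end SimpleGraph

open SimpleGraph in
theorem mainTheorem6 :
    -- the two listed classes are exactly the classes of locally equienergetic graphs of order 5
    locallyEquienergeticClasses 5 =
      {{isoType (completeGraph (Fin 5)) (by simp),
        isoType (completeGraph (Fin 3) ⊕g completeGraph (Fin 2)) (by simp),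
        isoType (cycleGraph 5) (by simp)},
       {isoType (completeGraph (Fin 4) ⊕g completeGraph (Fin 1)) (by simp),
        isoType ((completeGraph (Fin 2) ⊕g completeGraph (Fin 2)) ⊕g completeGraph (Fin 1))
          (by simp)}} ∧
    -- there are two of them
    (locallyEquienergeticClasses 5).ncard = 2 ∧
    -- the three graphs listed in the first class are pairwise non-isomorphic
    ({isoType (completeGraph (Fin 5)) (by simp),
      isoType (completeGraph (Fin 3) ⊕g completeGraph (Fin 2)) (by simp),
      isoType (cycleGraph 5) (by simp)} : Set (GraphOfOrder 5)).ncard = 3 ∧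
    -- the two graphs listed in the second class are non-isomorphic
    ({isoType (completeGraph (Fin 4) ⊕g completeGraph (Fin 1)) (by simp),
      isoType ((completeGraph (Fin 2) ⊕g completeGraph (Fin 2)) ⊕g completeGraph (Fin 1))
        (by simp)} : Set (GraphOfOrder 5)).ncard = 2 := by
  rw [isoType_K5, isoType_K3K2, isoType_C5, isoType_K4K1, isoType_K2K2K1]
  change _ = {classTen, classEight} ∧ _ ∧ classTen.ncard = 3 ∧ classEight.ncard = 2
  rw [locallyEquienergeticClasses_five]
  exact ⟨rfl, Set.ncard_pair classTen_ne_classEight, ncard_classTen, ncard_classEight⟩
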